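/- Fix a dimension $d\ge 1$. A $T$-query quantum algorithm with oracle access to a $d\times d$ unitary $U$ acts on a control qubit, a query register $\mathbb C^d$ and an ancilla register of arbitrary finite dimension; it starts in a computational basis state and applies $A_T\,Q_T\,A_{T-1}\,Q_{T-1}\cdots A_1\,Q_1\,A_0$, where $A_0,\dots,A_T$ are fixed unitaries not depending on $U$ and each query $Q_j$ is, as fixed in advance by the algorithm, either controlled-$U$ or controlled-$U^*$ (that is, $|0\rangle\langle 0|\otimes I\otimes I+|1\rangle\langle 1|\otimes V\otimes I$ with $V=U$ or $V=U^*$). Then all registers are measured in the computational basis, and the algorithm accepts if the outcome lies in a fixed set. For an integer $t\ge 0$ and a real $\epsilon>0$, the algorithm solves the $(t,\epsilon)$-Recurrence Time problem for $d$-dimensional unitaries if for every $d\times d$ unitary $U$ it accepts with probability at least $2/3$ when $U^t=I$ (yes case), and accepts with probability at most $1/3$ when $\|U^t-I\|\ge\epsilon$ in the spectral norm (no case). Theorem. The $(t,\epsilon)$-Recurrence Time problem for $d$-dimensional unitaries can be solved using $O(t\sqrt d/\epsilon)$ queries. That is, there is a universal constant $C>0$ such that for all integers $d\ge 1$ and $t\ge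 0$ and all real $\epsilon>0$ there is a $T$-query quantum algorithm with $T\le C\,t\sqrt d/\epsilon$ that solves the $(t,\epsilon)$-Recurrence Time problem for $d$-dimensional unitaries. -/

import Mathlib

open scoped Matrix Kronecker

/-- A `d`-dimensional unitary property: disjoint sets of *yes* and *no* instances
among the `d × d` unitary matrices. -/
structure UnitaryProperty (d : ℕ) where
  yes : Set (Matrix.unitaryGroup (Fin d) ℂ)
  no : Set (Matrix.unitaryGroup (Fin d) ℂ)
  disjoint : Disjoint yes no

/-- The spectral norm (the operator norm for the Euclidean norm on `ℂ^d`). -/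
noncomputable def matrixSpectralNorm {d : ℕ} (M : Matrix (Fin d) (Fin d) ℂ) : ℝ :=
  ‖Matrix.toEuclideanCLM (n := Fin d) (𝕜 := ℂ) M‖

/-- The `(t, ε)`-Recurrence Time problem in dimension `d`: decide whether `U ^ t = I` or
`‖U ^ t - I‖ ≥ ε` in the spectral norm. -/
def recurrenceTimeProblem (d t : ℕ) (ε : ℝ) (hε : 0 < ε) : UnitaryProperty d where
  yes := {U | U ^ t = 1}
  no := {U | ε ≤ matrixSpectralNorm ((U : Matrix (Fin d) (Fin d) ℂ) ^ t - 1)}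
  disjoint := by
    rw [Set.disjoint_left]
    intro U hy hn
    have h : (U : Matrix (Fin d) (Fin d) ℂ) ^ t = 1 := by
      simpa using congrArg Subtype.val (show U ^ t = 1 from hy)
    have hn' : ε ≤ matrixSpectralNorm ((U : Matrix (Fin d) (Fin d) ℂ) ^ t - 1) := hn
    simp only [h, matrixSpectralNorm, sub_self, map_zero, norm_zero] at hn'
    linarith

/-- The controlled oracle `|0⟩⟨0| ⊗ I ⊗ I + |1⟩⟨1| ⊗ V ⊗ I` on the control qubit, the query
register `ℂ^d` and the ancilla register `ℂ^κ`. -/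
noncomputable def controlled {d : ℕ} (κ : Type) [DecidableEq κ] (V : Matrix (Fin d) (Fin d) ℂ) :
    Matrix (Fin 2 × Fin d × κ) (Fin 2 × Fin d × κ) ℂ :=
  Matrix.single (0 : Fin 2) (0 : Fin 2) (1 : ℂ) ⊗ₖ
      ((1 : Matrix (Fin d) (Fin d) ℂ) ⊗ₖ (1 : Matrix κ κ ℂ)) +
    Matrix.single (1 : Fin 2) (1 : Fin 2) (1 : ℂ) ⊗ₖ (V ⊗ₖ (1 : Matrix κ κ ℂ))

/-- A quantum query algorithm with oracle access to a `d`-dimensional unitary `U`, acting on a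
control qubit, a query register `ℂ^d` and an ancilla register with computational basis `κ`.
It starts in a computational basis state, applies the fixed unitary `A₀`, and then, for each entry
`(b, A)` of `steps` in turn, makes one query and applies the fixed unitary `A`. The query is to
controlled-`U` if `b = false` and to controlled-`U*` if `b = true`. Finally all the registers are
measured in the computational basis; the algorithm accepts if the outcome lies in `accepting`. -/
structure QueryAlgorithm (d : ℕ) (κ : Type) [Fintype κ] [DecidableEq κ] where
  start : Fin 2 × Fin d × κ
  A₀ : Matrix.unitaryGroup (Fin 2 × Fin d × κ) ℂ
  steps : List (Bool × Matrix.unitaryGroup (Fin 2 × Fin d × κ) ℂ)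
  accepting : Finset (Fin 2 × Fin d × κ)

namespace QueryAlgorithm

variable {d : ℕ} {κ : Type} [Fintype κ] [DecidableEq κ]

/-- The number of queries (to controlled-`U` or controlled-`U*`) made by the algorithm. -/
def numQueries (Q : QueryAlgorithm d κ) : ℕ := Q.steps.length

/-- One query followed by one fixed unitary, applied to the state vector `ψ`. -/
noncomputable def applyStep (U : Matrix.unitaryGroup (Fin d) ℂ) (ψ : Fin 2 × Fin d × κ → ℂ)
    (s : Bool × Matrix.unitaryGroup (Fin 2 × Fin d × κ) ℂ) : Fin 2 × Fin d × κ → ℂ :=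
  (s.2 : Matrix (Fin 2 × Fin d × κ) (Fin 2 × Fin d × κ) ℂ) *ᵥ
    (controlled κ (if s.1 then (U : Matrix (Fin d) (Fin d) ℂ)ᴴ else U) *ᵥ ψ)

/-- The state before the final measurement, when the oracle is `U`. -/
noncomputable def finalState (Q : QueryAlgorithm d κ) (U : Matrix.unitaryGroup (Fin d) ℂ) :
    Fin 2 × Fin d × κ → ℂ :=
  Q.steps.foldl (applyStep U)
    ((Q.A₀ : Matrix (Fin 2 × Fin d × κ) (Fin 2 × Fin d × κ) ℂ) *ᵥ Pi.single Q.start 1)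

/-- The probability that the algorithm accepts, when the oracle is `U`. -/
noncomputable def acceptProb (Q : QueryAlgorithm d κ) (U : Matrix.unitaryGroup (Fin d) ℂ) : ℝ :=
  ∑ x ∈ Q.accepting, ‖Q.finalState U x‖ ^ 2

/-- The algorithm is a tester for `P`: it accepts *yes* instances with probability at least `2/3`
and *no* instances with probability at most `1/3`. -/
def IsTester (Q : QueryAlgorithm d κ) (P : UnitaryProperty d) : Prop :=
  (∀ U ∈ P.yes, 2 / 3 ≤ Q.acceptProb U) ∧ (∀ U ∈ P.no, Q.acceptProb U ≤ 1 / 3)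

end QueryAlgorithm

/-- `P` can be solved with `T` queries: some query algorithm, with a finite-dimensional ancilla
register, is a tester for `P` and makes `T` queries. -/
def SolvableWithQueries {d : ℕ} (P : UnitaryProperty d) (T : ℕ) : Prop :=
  ∃ (κ : Type) (_ : Fintype κ) (_ : DecidableEq κ) (Q : QueryAlgorithm d κ),
    Q.IsTester P ∧ Q.numQueries = T

/-! Write `W = U ^ t`, let `v` be `|+⟩ ⊗ Φ` with `Φ` maximally entangled, and let `S = |0⟩⟨1| ⊗ W* +
|1⟩⟨0| ⊗ W`, a self-adjoint unitary. Put `G = R S`, where `R` reflects about the line of `v`;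
applying `G` costs `2t` queries. If `W = 1`, then `G v = v`, and every ergodic average of `v` under
`G` has norm 1.

In general `p = v - S v` satisfies `S p = -p`, whence `p - G p = r² v` with `r = ‖p‖`. Thus `v` is a
coboundary for `G`: the sum of `G^k v` over `k < K` telescopes to `(p - G^K p) / r²`, of norm at
most `2 / r` (`norm_sum_reflections_pow_le`). Moreover `r²` is the squared Frobenius norm of `W - 1`
divided by `d` (`norm_sq_plusEntangled_sub`), so `r ≥ ε / √d` in the no case, and `K` of order `√d /
ε` makes the average small.

A clock register in uniform superposition over `k < K` turns the squared norm of the average into an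
acceptance probability (`exists_queryAlgorithm_ergodic`), with `2tK` queries in all. -/

open scoped Matrix Kronecker
open Matrix

/-! ### Composition of circuits and their query counts -/

/-- A family of matrices, indexed by the oracle, that is realised by a circuit of fixed unitaries
and `n` queries. -/
def QueryImplementable {d : ℕ} (κ : Type) [Fintype κ] [DecidableEq κ] (n : ℕ)
    (f : Matrix.unitaryGroup (Fin d) ℂ → Matrix (Fin 2 × Fin d × κ) (Fin 2 × Fin d × κ) ℂ) :
    Prop :=
  ∃ (A₀ : Matrix.unitaryGroup (Fin 2 × Fin d × κ) ℂ)
    (steps : List (Bool × Matrix.unitaryGroup (Fin 2 × Fin d × κ) ℂ)),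
    steps.length = n ∧ ∀ U ψ, steps.foldl (QueryAlgorithm.applyStep U)
      ((A₀ : Matrix (Fin 2 × Fin d × κ) (Fin 2 × Fin d × κ) ℂ) *ᵥ ψ) = f U *ᵥ ψ

namespace QueryImplementable

variable {d : ℕ} {κ : Type} [Fintype κ] [DecidableEq κ] {m n : ℕ}
  {f g : Matrix.unitaryGroup (Fin d) ℂ → Matrix (Fin 2 × Fin d × κ) (Fin 2 × Fin d × κ) ℂ}

theorem of_mem_unitaryGroup {A : Matrix (Fin 2 × Fin d × κ) (Fin 2 × Fin d × κ) ℂ}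
    (hA : A ∈ Matrix.unitaryGroup (Fin 2 × Fin d × κ) ℂ) :
    QueryImplementable κ 0 (fun _ : Matrix.unitaryGroup (Fin d) ℂ => A) :=
  ⟨⟨A, hA⟩, [], rfl, fun _ _ => rfl⟩

theorem query (b : Bool) : QueryImplementable κ 1
    (fun U : Matrix.unitaryGroup (Fin d) ℂ =>
      controlled κ (if b then (U : Matrix (Fin d) (Fin d) ℂ)ᴴ else U)) :=
  ⟨1, [(b, 1)], rfl, fun U ψ => by simp [QueryAlgorithm.applyStep]⟩

/-- The new gate is absorbed into the last fixed unitary of the circuit, which is `A₀` when there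
are no queries, so it is free. -/
theorem unitary_mul {A : Matrix (Fin 2 × Fin d × κ) (Fin 2 × Fin d × κ) ℂ}
    (hA : A ∈ Matrix.unitaryGroup (Fin 2 × Fin d × κ) ℂ) (hf : QueryImplementable κ n f) :
    QueryImplementable κ n (fun U => A * f U) := by
  obtain ⟨A₀, steps, hn, h⟩ := hf
  rcases List.eq_nil_or_concat steps with rfl | ⟨l, s, rfl⟩
  · refine ⟨⟨A, hA⟩ * A₀, [], hn, fun U ψ => ?_⟩
    have := h U ψ
    simp only [List.foldl_nil] at this
    simp [← mulVec_mulVec, ← this]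
  · refine ⟨A₀, l ++ [(s.1, ⟨A, hA⟩ * s.2)], by simpa using hn, fun U ψ => ?_⟩
    have := h U ψ
    rw [← mulVec_mulVec, ← this]
    simp [QueryAlgorithm.applyStep, mulVec_mulVec, mul_assoc]

theorem mul (hg : QueryImplementable κ m g) (hf : QueryImplementable κ n f) :
    QueryImplementable κ (n + m) (fun U => g U * f U) := by
  obtain ⟨B, l, hl, h⟩ := hg
  obtain ⟨A, l', hl', h'⟩ := hf.unitary_mul B.2
  refine ⟨A, l' ++ l, by simp [hl, hl'], fun U ψ => ?_⟩
  rw [List.foldl_append, h', ← mulVec_mulVec, h, mulVec_mulVec]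

theorem pow (hf : QueryImplementable κ n f) (k : ℕ) :
    QueryImplementable κ (k * n) (fun U => f U ^ k) := by
  induction k with
  | zero => simpa using of_mem_unitaryGroup (κ := κ) (d := d) (one_mem _)
  | succ k ih => simpa [Nat.succ_mul, add_comm, pow_succ] using ih.mul hf

end QueryImplementable

/-! ### Algebra of the controlled oracle -/

theorem controlled_one {d : ℕ} (κ : Type) [DecidableEq κ] :
    controlled κ (1 : Matrix (Fin d) (Fin d) ℂ) = 1 := by
  rw [controlled, ← Matrix.add_kronecker]
  have : Matrix.single (0 : Fin 2) (0 : Fin 2) (1 : ℂ) + Matrix.single 1 1 1 = 1 := by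
    ext i j; fin_cases i <;> fin_cases j <;> simp
  simp [this]

theorem controlled_mul {d : ℕ} (κ : Type) [Fintype κ] [DecidableEq κ]
    (V W : Matrix (Fin d) (Fin d) ℂ) :
    controlled κ V * controlled κ W = controlled κ (V * W) := by
  simp [controlled, add_mul, mul_add, ← Matrix.mul_kronecker_mul]

theorem controlled_pow {d : ℕ} (κ : Type) [Fintype κ] [DecidableEq κ]
    (V : Matrix (Fin d) (Fin d) ℂ) (t : ℕ) :
    controlled κ V ^ t = controlled κ (V ^ t) := by
  induction t with
  | zero => simp [controlled_one]
  | succ t ih => rw [pow_succ, ih, controlled_mul, pow_succ]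

theorem conjTranspose_controlled {d : ℕ} (κ : Type) [DecidableEq κ]
    (V : Matrix (Fin d) (Fin d) ℂ) : (controlled κ V)ᴴ = controlled κ Vᴴ := by
  simp [controlled, Matrix.conjTranspose_kronecker]

theorem controlled_mulVec_zero {d : ℕ} {κ : Type} [Fintype κ] [DecidableEq κ]
    (V : Matrix (Fin d) (Fin d) ℂ) (ψ : Fin 2 × Fin d × κ → ℂ) (x : Fin d) (y : κ) :
    (controlled κ V *ᵥ ψ) (0, x, y) = ψ (0, x, y) := by
  simp [controlled, mulVec, dotProduct, Fintype.sum_prod_type, Matrix.one_apply]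

theorem controlled_mulVec_one {d : ℕ} {κ : Type} [Fintype κ] [DecidableEq κ]
    (V : Matrix (Fin d) (Fin d) ℂ) (ψ : Fin 2 × Fin d × κ → ℂ) (x : Fin d) (y : κ) :
    (controlled κ V *ᵥ ψ) (1, x, y) = ∑ z, V x z * ψ (1, z, y) := by
  simp [controlled, mulVec, dotProduct, Fintype.sum_prod_type, Matrix.one_apply]

/-! ### Gates conditioned on a clock register -/

/-- Moving the second ancilla register to the end. -/
def splitAncilla (d : ℕ) (α β : Type) : Fin 2 × Fin d × (α × β) ≃ (Fin 2 × Fin d × α) × β where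
  toFun x := ((x.1, x.2.1, x.2.2.1), x.2.2.2)
  invFun x := (x.1.1, x.1.2.1, x.1.2.2, x.2)
  left_inv _ := rfl
  right_inv _ := rfl

/-- The matrix that applies `M k` to the other registers when the second ancilla register holds
`k`. -/
noncomputable def selectMatrix {d : ℕ} {α β : Type} [DecidableEq β]
    (M : β → Matrix (Fin 2 × Fin d × α) (Fin 2 × Fin d × α) ℂ) :
    Matrix (Fin 2 × Fin d × (α × β)) (Fin 2 × Fin d × (α × β)) ℂ :=
  (blockDiagonal M).submatrix (splitAncilla d α β) (splitAncilla d α β)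

theorem selectMatrix_one {d : ℕ} {α β : Type} [DecidableEq α] [DecidableEq β] :
    selectMatrix (fun _ : β => (1 : Matrix (Fin 2 × Fin d × α) (Fin 2 × Fin d × α) ℂ)) = 1 := by
  have := blockDiagonal_one (o := β) (m := Fin 2 × Fin d × α) (α := ℂ)
  rw [selectMatrix, show (fun _ : β => (1 : Matrix (Fin 2 × Fin d × α) (Fin 2 × Fin d × α) ℂ)) = 1
    from rfl, this, submatrix_one_equiv]

theorem selectMatrix_mul {d : ℕ} {α β : Type} [Fintype α] [Fintype β] [DecidableEq β]
    (M N : β → Matrix (Fin 2 × Fin d × α) (Fin 2 × Fin d × α) ℂ) :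
    selectMatrix M * selectMatrix N = selectMatrix (fun k => M k * N k) := by
  rw [selectMatrix, selectMatrix, submatrix_mul_equiv, ← blockDiagonal_mul]; rfl

theorem selectMatrix_mem_unitaryGroup {d : ℕ} {α β : Type} [Fintype α] [DecidableEq α]
    [Fintype β] [DecidableEq β]
    {M : β → Matrix (Fin 2 × Fin d × α) (Fin 2 × Fin d × α) ℂ}
    (hM : ∀ k, M k ∈ Matrix.unitaryGroup (Fin 2 × Fin d × α) ℂ) :
    selectMatrix M ∈ Matrix.unitaryGroup (Fin 2 × Fin d × (α × β)) ℂ := by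
  have h : star (selectMatrix M) = selectMatrix (fun k => star (M k)) := by
    simp [selectMatrix, star_eq_conjTranspose, blockDiagonal_conjTranspose]
  rw [Matrix.mem_unitaryGroup_iff, h, selectMatrix_mul]
  simp only [fun k => (Matrix.mem_unitaryGroup_iff.1 (hM k)), selectMatrix_one]

theorem selectMatrix_mulVec {d : ℕ} {α β : Type} [Fintype α] [Fintype β] [DecidableEq β]
    (M : β → Matrix (Fin 2 × Fin d × α) (Fin 2 × Fin d × α) ℂ)
    (ψ : Fin 2 × Fin d × (α × β) → ℂ) (b : Fin 2) (x : Fin d) (y : α) (k : β) :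
    (selectMatrix M *ᵥ ψ) (b, x, y, k) =
      (M k *ᵥ fun s => ψ (s.1, s.2.1, s.2.2, k)) (b, x, y) := by
  simp only [selectMatrix, mulVec, dotProduct, Fintype.sum_prod_type, submatrix_apply,
    splitAncilla, Equiv.coe_fn_mk, blockDiagonal_apply]
  simp

theorem controlled_prod {d : ℕ} {α β : Type} [DecidableEq α] [DecidableEq β]
    (V : Matrix (Fin d) (Fin d) ℂ) :
    controlled (α × β) V = selectMatrix (fun _ => controlled α V) := by
  ext ⟨b, x, y, k⟩ ⟨b', x', y', k'⟩
  by_cases h : k = k' <;> by_cases h' : y = y' <;>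
    simp [controlled, selectMatrix, splitAncilla, blockDiagonal_apply, Matrix.one_apply, h, h']

/-! ### State preparation and unitary invariance of the norm -/

/-- Every unit vector is the image of a given basis vector under some unitary matrix. -/
theorem exists_mem_unitaryGroup_mulVec_single {ι : Type} [Fintype ι] [DecidableEq ι] (i : ι)
    (v : ι → ℂ) (hv : ∑ j, ‖v j‖ ^ 2 = 1) :
    ∃ A ∈ Matrix.unitaryGroup ι ℂ, ∀ j, A j i = v j := by
  have hv' : ‖WithLp.toLp 2 v‖ = 1 := by
    rw [EuclideanSpace.norm_eq]; simp [hv]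
  -- Restricting to the single index `i` makes the extended orthonormal basis carry `v` at position
  -- `i`, hence in column `i`.
  have ho : Orthonormal ℂ (Set.domRestrict {i} (fun _ : ι => WithLp.toLp 2 v)) := by
    rw [orthonormal_iff_ite]
    rintro ⟨a, rfl⟩ ⟨b, rfl⟩
    change inner ℂ (WithLp.toLp 2 v) (WithLp.toLp 2 v) = _
    simp [inner_self_eq_norm_sq_to_K, hv']
  obtain ⟨b, hb⟩ := ho.exists_orthonormalBasis_extension_of_card_eq (by simp)
  refine ⟨_, (EuclideanSpace.basisFun ι ℂ).toMatrix_orthonormalBasis_mem_unitary b, fun j => ?_⟩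
  simp [Module.Basis.toMatrix_apply, hb i rfl]

theorem norm_toLp_mulVec {ι : Type} [Fintype ι] [DecidableEq ι] {A : Matrix ι ι ℂ}
    (hA : A ∈ Matrix.unitaryGroup ι ℂ) (x : ι → ℂ) :
    ‖WithLp.toLp 2 (A *ᵥ x)‖ = ‖WithLp.toLp 2 x‖ := by
  have h : star (A *ᵥ x) ⬝ᵥ (A *ᵥ x) = star x ⬝ᵥ x := by
    rw [star_mulVec, dotProduct_mulVec, vecMul_vecMul, ← star_eq_conjTranspose,
      Matrix.mem_unitaryGroup_iff'.1 hA, vecMul_one]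
  have h2 : ∀ y : ι → ℂ, ((‖WithLp.toLp 2 y‖ ^ 2 : ℝ) : ℂ) = star y ⬝ᵥ y := fun y => by
    rw [EuclideanSpace.norm_sq_eq]
    simp [dotProduct, ← Complex.normSq_eq_norm_sq, Complex.normSq_eq_conj_mul_self]
  have h3 := (h2 (A *ᵥ x)).trans (h.trans (h2 x).symm)
  exact (sq_eq_sq₀ (norm_nonneg _) (norm_nonneg _)).1 (by exact_mod_cast h3)

/-! ### Ergodic averages for a product of two reflections -/

/-- The reflection about the line spanned by the unit vector `v`. -/
noncomputable def lineReflection {ι : Type} [DecidableEq ι] (v : ι → ℂ) : Matrix ι ι ℂ :=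
  (2 : ℂ) • vecMulVec v (star v) - 1

section Reflections

variable {ι : Type} [Fintype ι] [DecidableEq ι] {v : ι → ℂ} {S : Matrix ι ι ℂ}

theorem lineReflection_mulVec (v x : ι → ℂ) :
    lineReflection v *ᵥ x = (2 * (star v ⬝ᵥ x)) • v - x := by
  simp [lineReflection, sub_mulVec, smul_mulVec, vecMulVec_mulVec, mul_smul]

theorem lineReflection_mem_unitaryGroup (hv : star v ⬝ᵥ v = 1) :
    lineReflection v ∈ Matrix.unitaryGroup ι ℂ := by
  have h : star (lineReflection v) = lineReflection v := by
    simp [lineReflection, star_eq_conjTranspose, conjTranspose_vecMulVec]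
  rw [Matrix.mem_unitaryGroup_iff, h]
  refine Matrix.ext_of_mulVec_single fun i => ?_
  rw [← mulVec_mulVec]
  simp only [lineReflection_mulVec, dotProduct_sub, dotProduct_smul, hv, one_mulVec]
  module

/-- The ergodic averages of a product of two reflections, applied to a vector `v` spanning the
line of the second reflection, decay at a rate governed by the distance that the first reflection
moves `v`. -/
theorem norm_sum_reflections_pow_le (hv : star v ⬝ᵥ v = 1) (hS : S ∈ Matrix.unitaryGroup ι ℂ)
    (hS' : S.IsHermitian) (hne : v - S *ᵥ v ≠ 0) (K : ℕ) :
    ‖WithLp.toLp 2 (∑ k ∈ Finset.range K, ((lineReflection v * S) ^ k) *ᵥ v)‖ ≤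
      2 / ‖WithLp.toLp 2 (v - S *ᵥ v)‖ := by
  set G := lineReflection v * S with hG
  have hGu : G ∈ Matrix.unitaryGroup ι ℂ := mul_mem (lineReflection_mem_unitaryGroup hv) hS
  set p := v - S *ᵥ v with hp
  set r := ‖WithLp.toLp 2 p‖ with hr
  have hr0 : 0 < r := norm_pos_iff.2 (by simpa using hne)
  have hSS : S * S = 1 := by
    have := Matrix.mem_unitaryGroup_iff.1 hS
    rwa [star_eq_conjTranspose, hS'.eq] at this
  have hSp : S *ᵥ p = -p := by simp [hp, mulVec_sub, mulVec_mulVec, hSS]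
  have hSv : star (S *ᵥ v) = star v ᵥ* S := by rw [star_mulVec, hS'.eq]
  -- `⟨p, p⟩ = ⟨v, p⟩ - ⟨S v, p⟩ = ⟨v, p⟩ - ⟨v, S p⟩`, and `S p = -p`.
  have hvp : 2 * (star v ⬝ᵥ p) = ((r ^ 2 : ℝ) : ℂ) := by
    have h2 : ((r ^ 2 : ℝ) : ℂ) = star p ⬝ᵥ p := by
      rw [hr, EuclideanSpace.norm_sq_eq]
      simp [dotProduct, ← Complex.normSq_eq_norm_sq, Complex.normSq_eq_conj_mul_self]
    rw [h2]
    conv_rhs => rw [hp, star_sub, sub_dotProduct, hSv, ← dotProduct_mulVec, ← hp, hSp]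
    rw [dotProduct_neg]; ring
  -- The coboundary identity that makes the sum of the `G ^ k *ᵥ v` telescope.
  have hGp : p - G *ᵥ p = ((r ^ 2 : ℝ) : ℂ) • v := by
    rw [hG, ← mulVec_mulVec, hSp, lineReflection_mulVec, dotProduct_neg, mul_neg, hvp]
    module
  have hsum : (((r ^ 2 : ℝ) : ℂ)) • ∑ k ∈ Finset.range K, (G ^ k) *ᵥ v = p - (G ^ K) *ᵥ p := by
    rw [Finset.smul_sum]
    simp_rw [← mulVec_smul, ← hGp, mulVec_sub, mulVec_mulVec, ← pow_succ]
    rw [Finset.sum_range_sub' (fun k => G ^ k *ᵥ p)]; simp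
  have hn := congrArg (fun x => ‖WithLp.toLp 2 x‖) hsum
  simp only [WithLp.toLp_smul, norm_smul] at hn
  have hle : ‖WithLp.toLp 2 (p - (G ^ K) *ᵥ p)‖ ≤ 2 * r := by
    rw [WithLp.toLp_sub]
    refine (norm_sub_le _ _).trans ?_
    rw [norm_toLp_mulVec (pow_mem hGu K)]
    linarith
  rw [← hn, Complex.norm_real, Real.norm_of_nonneg (by positivity)] at hle
  rw [le_div_iff₀ hr0]
  nlinarith

end Reflections

/-- The spectral norm is at most the Frobenius norm. -/
theorem matrixSpectralNorm_sq_le {d : ℕ} (M : Matrix (Fin d) (Fin d) ℂ) :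
    matrixSpectralNorm M ^ 2 ≤ ∑ i, ∑ j, ‖M i j‖ ^ 2 := by
  have h0 : 0 ≤ ∑ i, ∑ j, ‖M i j‖ ^ 2 := by positivity
  refine (Real.le_sqrt (norm_nonneg _) h0).1 ?_
  refine ContinuousLinearMap.opNorm_le_bound _ (Real.sqrt_nonneg _) fun x => ?_
  refine (sq_le_sq₀ (norm_nonneg _) (by positivity)).1 ?_
  rw [mul_pow, Real.sq_sqrt h0, EuclideanSpace.norm_sq_eq, EuclideanSpace.norm_sq_eq,
    Finset.sum_mul]
  refine Finset.sum_le_sum fun i _ => ?_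
  calc _ = ‖∑ j, M i j * x j‖ ^ 2 := by simp [mulVec, dotProduct]
    _ ≤ (∑ j, ‖M i j‖ * ‖x j‖) ^ 2 := by
      gcongr; exact (norm_sum_le _ _).trans_eq (by simp)
    _ ≤ _ := Finset.sum_mul_sq_le_sq_mul_sq _ _ _

theorem QueryImplementable.exists_queryAlgorithm {d : ℕ} {κ : Type} [Fintype κ] [DecidableEq κ]
    {n : ℕ} {f : Matrix.unitaryGroup (Fin d) ℂ → Matrix (Fin 2 × Fin d × κ) (Fin 2 × Fin d × κ) ℂ}
    (hf : QueryImplementable κ n f) (start : Fin 2 × Fin d × κ)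
    (accepting : Finset (Fin 2 × Fin d × κ)) :
    ∃ Q : QueryAlgorithm d κ, Q.numQueries = n ∧
      ∀ U, Q.acceptProb U = ∑ x ∈ accepting, ‖f U x start‖ ^ 2 := by
  obtain ⟨A, steps, hn, h⟩ := hf
  refine ⟨⟨start, A, steps, accepting⟩, hn, fun U => ?_⟩
  simp only [QueryAlgorithm.acceptProb, QueryAlgorithm.finalState, h]
  simp

/-! ### The reflection built from `W` and its action on the test state -/

/-- The Pauli `X` gate on the control qubit. -/
noncomputable def flipControl (d : ℕ) (α : Type) [DecidableEq α] :
    Matrix (Fin 2 × Fin d × α) (Fin 2 × Fin d × α) ℂ :=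
  !![0, 1; 1, 0] ⊗ₖ (1 : Matrix (Fin d × α) (Fin d × α) ℂ)

section

variable {d : ℕ} {α : Type} [DecidableEq α]

theorem isHermitian_flipControl : (flipControl d α).IsHermitian := by
  have h : (!![0, 1; 1, 0] : Matrix (Fin 2) (Fin 2) ℂ)ᴴ = !![0, 1; 1, 0] := by
    ext i j; fin_cases i <;> fin_cases j <;> simp
  rw [IsHermitian, flipControl, conjTranspose_kronecker, h, conjTranspose_one]

theorem flipControl_mem_unitaryGroup [Fintype α] :
    flipControl d α ∈ Matrix.unitaryGroup (Fin 2 × Fin d × α) ℂ := by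
  rw [Matrix.mem_unitaryGroup_iff, star_eq_conjTranspose, isHermitian_flipControl.eq, flipControl,
    ← mul_kronecker_mul]
  have h : (!![0, 1; 1, 0] * !![0, 1; 1, 0] : Matrix (Fin 2) (Fin 2) ℂ) = 1 := by
    ext i j; fin_cases i <;> fin_cases j <;> simp
  rw [h, one_mul, one_kronecker_one]

theorem flipControl_mulVec [Fintype α] (ψ : Fin 2 × Fin d × α → ℂ) (b : Fin 2) (x : Fin d) (y : α) :
    (flipControl d α *ᵥ ψ) (b, x, y) = ψ (1 - b, x, y) := by
  fin_cases b <;>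
    simp [flipControl, mulVec, dotProduct, Fintype.sum_prod_type, Matrix.one_apply, Prod.ext_iff,
      ite_and]

theorem controlled_mem_unitaryGroup [Fintype α] {V : Matrix (Fin d) (Fin d) ℂ}
    (hV : V ∈ Matrix.unitaryGroup (Fin d) ℂ) :
    controlled α V ∈ Matrix.unitaryGroup (Fin 2 × Fin d × α) ℂ := by
  rw [Matrix.mem_unitaryGroup_iff, star_eq_conjTranspose, conjTranspose_controlled,
    controlled_mul, ← star_eq_conjTranspose, Matrix.mem_unitaryGroup_iff.1 hV, controlled_one]

/-- The self-adjoint unitary `|0⟩⟨1| ⊗ W* + |1⟩⟨0| ⊗ W`. -/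
noncomputable def swapReflection (α : Type) [Fintype α] [DecidableEq α]
    (W : Matrix (Fin d) (Fin d) ℂ) : Matrix (Fin 2 × Fin d × α) (Fin 2 × Fin d × α) ℂ :=
  controlled α W * flipControl d α * controlled α Wᴴ

variable [Fintype α]

theorem isHermitian_swapReflection (W : Matrix (Fin d) (Fin d) ℂ) :
    (swapReflection α W).IsHermitian := by
  simp [IsHermitian, swapReflection, conjTranspose_controlled, isHermitian_flipControl.eq,
    mul_assoc]

theorem swapReflection_mem_unitaryGroup {W : Matrix (Fin d) (Fin d) ℂ}
    (hW : W ∈ Matrix.unitaryGroup (Fin d) ℂ) :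
    swapReflection α W ∈ Matrix.unitaryGroup (Fin 2 × Fin d × α) ℂ :=
  mul_mem (mul_mem (controlled_mem_unitaryGroup hW) flipControl_mem_unitaryGroup)
    (controlled_mem_unitaryGroup (Unitary.star_mem hW))

end

/-- The state `|+⟩ ⊗ Φ`, with `Φ` the maximally entangled state of the query register and a
reference register. -/
noncomputable def plusEntangled (d : ℕ) : Fin 2 × Fin d × Fin d → ℂ :=
  fun s => if s.2.1 = s.2.2 then (((√(2 * d))⁻¹ : ℝ) : ℂ) else 0

theorem sum_norm_sq_plusEntangled {d : ℕ} (hd : 1 ≤ d) : ∑ s, ‖plusEntangled d s‖ ^ 2 = 1 := by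
  have h : ∀ x y : Fin d, ‖(if x = y then (((√(2 * d))⁻¹ : ℝ) : ℂ) else 0)‖ ^ 2 =
      if x = y then (2 * d : ℝ)⁻¹ else 0 := fun x y => by
    split_ifs
    · rw [Complex.norm_real, Real.norm_of_nonneg (by positivity), inv_pow,
        Real.sq_sqrt (by positivity)]
    · simp
  have hd' : (d : ℝ) ≠ 0 := by positivity
  simp only [plusEntangled, Fintype.sum_prod_type, h, Finset.sum_ite_eq, Finset.mem_univ, if_true,
    Finset.sum_const, Finset.card_univ, Fintype.card_fin, nsmul_eq_mul]
  push_cast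
  field_simp

theorem star_dotProduct_self_eq {ι : Type} [Fintype ι] (v : ι → ℂ) :
    star v ⬝ᵥ v = ((∑ s, ‖v s‖ ^ 2 : ℝ) : ℂ) := by
  simp [dotProduct, ← Complex.normSq_eq_norm_sq, Complex.normSq_eq_conj_mul_self]

theorem star_plusEntangled_dotProduct {d : ℕ} (hd : 1 ≤ d) :
    star (plusEntangled d) ⬝ᵥ plusEntangled d = 1 := by
  rw [star_dotProduct_self_eq, sum_norm_sq_plusEntangled hd, Complex.ofReal_one]

theorem swapReflection_mulVec_plusEntangled_zero {d : ℕ} (W : Matrix (Fin d) (Fin d) ℂ)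
    (x y : Fin d) : (swapReflection (Fin d) W *ᵥ plusEntangled d) (0, x, y) =
      Wᴴ x y * (((√(2 * d))⁻¹ : ℝ) : ℂ) := by
  rw [swapReflection, ← mulVec_mulVec, ← mulVec_mulVec, controlled_mulVec_zero,
    flipControl_mulVec, sub_zero, controlled_mulVec_one]
  simp [plusEntangled]

theorem swapReflection_mulVec_plusEntangled_one {d : ℕ} (W : Matrix (Fin d) (Fin d) ℂ)
    (x y : Fin d) : (swapReflection (Fin d) W *ᵥ plusEntangled d) (1, x, y) =
      W x y * (((√(2 * d))⁻¹ : ℝ) : ℂ) := by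
  rw [swapReflection, ← mulVec_mulVec, ← mulVec_mulVec, controlled_mulVec_one]
  simp only [flipControl_mulVec, sub_self, controlled_mulVec_zero]
  simp [plusEntangled]

theorem swapReflection_one_mulVec_plusEntangled (d : ℕ) :
    swapReflection (Fin d) (1 : Matrix (Fin d) (Fin d) ℂ) *ᵥ plusEntangled d =
      plusEntangled d := by
  ext ⟨b, x, y⟩
  fin_cases b
  · simpa [plusEntangled, Matrix.one_apply, eq_comm] using
      swapReflection_mulVec_plusEntangled_zero (1 : Matrix (Fin d) (Fin d) ℂ) x y
  · simpa [plusEntangled, Matrix.one_apply] using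
      swapReflection_mulVec_plusEntangled_one (1 : Matrix (Fin d) (Fin d) ℂ) x y

/-- The two control values contribute the entries of `1 - W*` and `1 - W`, which have equal
Frobenius norms, each with weight `1 / (2d)`. -/
theorem norm_sq_plusEntangled_sub {d : ℕ} (W : Matrix (Fin d) (Fin d) ℂ) :
    ‖WithLp.toLp 2 (plusEntangled d - swapReflection (Fin d) W *ᵥ plusEntangled d)‖ ^ 2 =
      (∑ i, ∑ j, ‖(W - 1) i j‖ ^ 2) / d := by
  have h1 : ∀ x y : Fin d, ‖(if x = y then (((√(2 * d))⁻¹ : ℝ) : ℂ) else 0) -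
      W x y * (((√(2 * d))⁻¹ : ℝ) : ℂ)‖ ^ 2 = ‖(W - 1) x y‖ ^ 2 * (2 * d : ℝ)⁻¹ := fun x y => by
    have : (if x = y then (((√(2 * d))⁻¹ : ℝ) : ℂ) else 0) - W x y * (((√(2 * d))⁻¹ : ℝ) : ℂ) =
        -((W - 1) x y) * (((√(2 * d))⁻¹ : ℝ) : ℂ) := by
      by_cases h : x = y <;> simp [h] <;> ring
    rw [this, norm_mul, norm_neg, mul_pow, Complex.norm_real,
      Real.norm_of_nonneg (by positivity), inv_pow, Real.sq_sqrt (by positivity)]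
  have h2 : ∀ x y : Fin d, ‖(if x = y then (((√(2 * d))⁻¹ : ℝ) : ℂ) else 0) -
      Wᴴ x y * (((√(2 * d))⁻¹ : ℝ) : ℂ)‖ ^ 2 = ‖(W - 1) y x‖ ^ 2 * (2 * d : ℝ)⁻¹ := fun x y => by
    rw [← h1 y x, ← norm_star]
    congr 2
    by_cases h : x = y <;> simp [h, eq_comm]
  rw [EuclideanSpace.norm_sq_eq]
  simp only [Fintype.sum_prod_type, Fin.sum_univ_two, Pi.sub_apply,
    swapReflection_mulVec_plusEntangled_zero, swapReflection_mulVec_plusEntangled_one]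
  simp only [plusEntangled, h1, h2, ← Finset.sum_mul]
  rw [Finset.sum_comm, mul_inv]
  ring

/-! ### Query cost of the clocked rotation, and the averaging circuit -/

/-- The product of the two reflections, iterated by the recurrence time tester. -/
noncomputable def testerRotation {d : ℕ} (W : Matrix (Fin d) (Fin d) ℂ) :
    Matrix (Fin 2 × Fin d × Fin d) (Fin 2 × Fin d × Fin d) ℂ :=
  lineReflection (plusEntangled d) * swapReflection (Fin d) W

theorem testerRotation_one_pow_mulVec {d : ℕ} (hd : 1 ≤ d) (k : ℕ) :
    testerRotation (1 : Matrix (Fin d) (Fin d) ℂ) ^ k *ᵥ plusEntangled d = plusEntangled d := by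
  have h : testerRotation (1 : Matrix (Fin d) (Fin d) ℂ) *ᵥ plusEntangled d =
      plusEntangled d := by
    rw [testerRotation, ← mulVec_mulVec, swapReflection_one_mulVec_plusEntangled,
      lineReflection_mulVec, star_plusEntangled_dotProduct hd]
    module
  induction k with
  | zero => simp
  | succ k ih => rw [pow_succ, ← mulVec_mulVec, h, ih]

/-- A conditional application of the rotation for `U ^ t` takes `2 * t` queries. -/
theorem queryImplementable_selectMatrix_testerRotation {d : ℕ} (hd : 1 ≤ d) (t K j : ℕ) :
    QueryImplementable (Fin d × Fin K) (2 * t) (fun U => selectMatrix (fun k : Fin K =>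
      if j < k then testerRotation ((U : Matrix (Fin d) (Fin d) ℂ) ^ t) else 1)) := by
  -- Only the fixed gates `R` and `X` depend on the clock; the queries always run. Where `X` is
  -- switched off, the controlled powers of `U` and `U*` cancel.
  have hR : selectMatrix (fun k : Fin K => if j < k then lineReflection (plusEntangled d) else 1) ∈
      Matrix.unitaryGroup (Fin 2 × Fin d × (Fin d × Fin K)) ℂ :=
    selectMatrix_mem_unitaryGroup fun k => by
      split_ifs
      exacts [lineReflection_mem_unitaryGroup (star_plusEntangled_dotProduct hd), one_mem _]
  have hX : selectMatrix (fun k : Fin K => if j < k then flipControl d (Fin d) else 1) ∈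
      Matrix.unitaryGroup (Fin 2 × Fin d × (Fin d × Fin K)) ℂ :=
    selectMatrix_mem_unitaryGroup fun k => by
      split_ifs
      exacts [flipControl_mem_unitaryGroup, one_mem _]
  have h := (((QueryImplementable.query (d := d) (κ := Fin d × Fin K) false).pow t).mul
    (((QueryImplementable.query (d := d) (κ := Fin d × Fin K) true).pow t).unitary_mul
      hX)).unitary_mul hR
  convert h using 1
  · ring
  · funext U
    simp only [Bool.false_eq_true, if_false, if_true, controlled_pow]
    simp only [controlled_prod, selectMatrix_mul]
    refine congrArg selectMatrix (funext fun k => ?_)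
    split_ifs
    · rw [testerRotation, swapReflection, conjTranspose_pow]; simp only [mul_assoc]
    · have hU : (U : Matrix (Fin d) (Fin d) ℂ) ^ t * (U : Matrix (Fin d) (Fin d) ℂ)ᴴ ^ t = 1 := by
        rw [← conjTranspose_pow]
        exact Matrix.mem_unitaryGroup_iff.1 (pow_mem U.2 t)
      rw [one_mul, one_mul, controlled_mul, hU, controlled_one]

/-- Factor `j` acts only on clock values above `j`, so `J` factors give the exponent `min J k`; for
`J = K` this is `k`. -/
theorem queryImplementable_selectMatrix_testerRotation_pow {d : ℕ} (hd : 1 ≤ d) (t K J : ℕ) :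
    QueryImplementable (Fin d × Fin K) (J * (2 * t)) (fun U => selectMatrix (fun k : Fin K =>
      testerRotation ((U : Matrix (Fin d) (Fin d) ℂ) ^ t) ^ min J k)) := by
  induction J with
  | zero =>
    simpa [selectMatrix_one] using
      QueryImplementable.of_mem_unitaryGroup (κ := Fin d × Fin K) (d := d) (one_mem _)
  | succ J ih =>
    convert (queryImplementable_selectMatrix_testerRotation hd t K J).mul ih using 1
    · ring
    · funext U
      rw [selectMatrix_mul]
      congr 1
      funext k
      split_ifs with h
      · rw [← pow_succ', min_eq_left h.le, min_eq_left (Nat.succ_le_of_lt h)]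
      · rw [one_mul, min_eq_right (by omega), min_eq_right (by omega)]

theorem sum_norm_sq_mul_inv_sqrt {ι : Type} [Fintype ι] (v : ι → ℂ) (hv : ∑ s, ‖v s‖ ^ 2 = 1)
    {K : ℕ} (hK : K ≠ 0) :
    ∑ s, ∑ _k : Fin K, ‖v s * (((√K)⁻¹ : ℝ) : ℂ)‖ ^ 2 = 1 := by
  have h : ∀ s, ‖v s * (((√K)⁻¹ : ℝ) : ℂ)‖ ^ 2 = ‖v s‖ ^ 2 * (K : ℝ)⁻¹ := fun s => by
    rw [norm_mul, mul_pow, Complex.norm_real, Real.norm_of_nonneg (by positivity), inv_pow,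
      Real.sq_sqrt (by positivity)]
  have hK' : (K : ℝ) ≠ 0 := by positivity
  simp only [h, Finset.sum_const, Finset.card_univ, Fintype.card_fin, nsmul_eq_mul,
    ← Finset.mul_sum, ← Finset.sum_mul, hv]
  field_simp

/-- The ergodic averages of the rotation for `U ^ t` are the acceptance amplitudes of some query
algorithm. -/
theorem exists_queryAlgorithm_ergodic {d : ℕ} (hd : 1 ≤ d) (t K : ℕ) (hK : K ≠ 0) :
    ∃ Q : QueryAlgorithm d (Fin d × Fin K), Q.numQueries = K * (2 * t) ∧
      ∀ U : Matrix.unitaryGroup (Fin d) ℂ, Q.acceptProb U =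
        (‖WithLp.toLp 2 (∑ k ∈ Finset.range K,
          testerRotation ((U : Matrix (Fin d) (Fin d) ℂ) ^ t) ^ k *ᵥ plusEntangled d)‖ / K) ^ 2 := by
  have : NeZero K := ⟨hK⟩
  have : NeZero d := ⟨by omega⟩
  obtain ⟨A, hA, hA'⟩ := exists_mem_unitaryGroup_mulVec_single
    ((0, 0, 0, 0) : Fin 2 × Fin d × (Fin d × Fin K))
    (fun s => plusEntangled d (s.1, s.2.1, s.2.2.1) * (((√K)⁻¹ : ℝ) : ℂ)) (by
      have := sum_norm_sq_mul_inv_sqrt _ (sum_norm_sq_plusEntangled hd) hK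
      simpa only [Fintype.sum_prod_type] using this)
  obtain ⟨B, hB, hB'⟩ := exists_mem_unitaryGroup_mulVec_single (0 : Fin K)
    (fun _ => (((√K)⁻¹ : ℝ) : ℂ)) (by
      simp [hK])
  -- After `B*` on the clock, reading `0` there amounts to projecting onto the uniform
  -- superposition. Preparation and projection each contribute `1 / √K`, which together give the
  -- average.
  have hF : (1 : Matrix (Fin 2) (Fin 2) ℂ) ⊗ₖ ((1 : Matrix (Fin d) (Fin d) ℂ) ⊗ₖ
      ((1 : Matrix (Fin d) (Fin d) ℂ) ⊗ₖ star B)) ∈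
      Matrix.unitaryGroup (Fin 2 × Fin d × (Fin d × Fin K)) ℂ :=
    kronecker_mem_unitary (one_mem _) (kronecker_mem_unitary (one_mem _)
      (kronecker_mem_unitary (one_mem _) (Unitary.star_mem hB)))
  obtain ⟨Q, hQ, hQ'⟩ := (((queryImplementable_selectMatrix_testerRotation_pow hd t K K).mul
    (QueryImplementable.of_mem_unitaryGroup hA)).unitary_mul hF).exists_queryAlgorithm (0, 0, 0, 0)
    (Finset.univ.filter fun s => s.2.2.2 = 0)
  refine ⟨Q, by simpa using hQ, fun U => ?_⟩
  rw [hQ']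
  set G := testerRotation ((U : Matrix (Fin d) (Fin d) ℂ) ^ t) with hG
  have hmid : ∀ (b : Fin 2) (x y : Fin d) (k : Fin K),
      (selectMatrix (fun k : Fin K => G ^ min K k) * A) (b, x, y, k) (0, 0, 0, 0) =
        (((√K)⁻¹ : ℝ) : ℂ) * (G ^ (k : ℕ) *ᵥ plusEntangled d) (b, x, y) := fun b x y k => by
    have h := selectMatrix_mulVec (fun k : Fin K => G ^ min K k)
      (fun s => A s (0, 0, 0, 0)) b x y k
    simp only [hA', min_eq_right k.2.le] at h
    have h' : (fun s : Fin 2 × Fin d × Fin d =>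
        plusEntangled d (s.1, s.2.1, s.2.2) * (((√K)⁻¹ : ℝ) : ℂ)) =
        (((√K)⁻¹ : ℝ) : ℂ) • plusEntangled d := by
      ext s; simp [mul_comm]
    rw [h', mulVec_smul, Pi.smul_apply, smul_eq_mul] at h
    rw [← h, Matrix.mul_apply]
    simp only [hA', mulVec, dotProduct]
  have hamp : ∀ (b : Fin 2) (x y : Fin d),
      ((1 : Matrix (Fin 2) (Fin 2) ℂ) ⊗ₖ ((1 : Matrix (Fin d) (Fin d) ℂ) ⊗ₖ
      ((1 : Matrix (Fin d) (Fin d) ℂ) ⊗ₖ star B)) *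
      (selectMatrix (fun k : Fin K => G ^ min K k) * A)) (b, x, y, 0) (0, 0, 0, 0) =
        (∑ k ∈ Finset.range K, G ^ k *ᵥ plusEntangled d) (b, x, y) / K := fun b x y => by
    have hs : (((√K)⁻¹ : ℝ) : ℂ) * (((√K)⁻¹ : ℝ) : ℂ) = (K : ℂ)⁻¹ := by
      rw [← Complex.ofReal_mul, ← mul_inv, Real.mul_self_sqrt (by positivity)]; simp
    rw [Matrix.mul_apply]
    simp only [Fintype.sum_prod_type, hmid]
    simp only [kronecker_apply, Matrix.one_apply, star_apply, hB', Finset.sum_apply, ite_mul,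
      one_mul, zero_mul, Finset.sum_ite_irrel, Finset.sum_const_zero, Finset.sum_ite_eq,
      Finset.mem_univ, if_true, Complex.star_def, Complex.conj_ofReal, ← mul_assoc, hs]
    rw [← Finset.mul_sum, div_eq_inv_mul,
      Fin.sum_univ_eq_sum_range (fun k => (G ^ k *ᵥ plusEntangled d) (b, x, y))]
  rw [div_pow, EuclideanSpace.norm_sq_eq, Finset.sum_filter]
  simp only [Fintype.sum_prod_type, Finset.sum_ite_eq', Finset.mem_univ, if_true, hamp, norm_div,
    Complex.norm_natCast, div_pow, ← Finset.sum_div]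

/-! ### Correctness of the tester and the final query bound -/

theorem matrixSpectralNorm_sub_one_le_two {d : ℕ} {W : Matrix (Fin d) (Fin d) ℂ}
    (hW : W ∈ Matrix.unitaryGroup (Fin d) ℂ) : matrixSpectralNorm (W - 1) ≤ 2 := by
  refine ContinuousLinearMap.opNorm_le_bound _ (by norm_num) fun x => ?_
  have h : Matrix.toEuclideanCLM (n := Fin d) (𝕜 := ℂ) (W - 1) x =
      WithLp.toLp 2 (W *ᵥ x.ofLp) - x := by
    rw [map_sub, map_one]; rfl
  rw [h]
  refine (norm_sub_le _ _).trans ?_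
  rw [norm_toLp_mulVec hW]
  exact (two_mul ‖x‖).ge

/-- If no unitary is a *no* instance, then the problem is solved without queries. -/
theorem solvableWithQueries_zero {d : ℕ} (hd : 1 ≤ d) (P : UnitaryProperty d) (hP : P.no = ∅) :
    SolvableWithQueries P 0 := by
  have : NeZero d := ⟨by omega⟩
  refine ⟨Unit, inferInstance, inferInstance, ⟨(0, 0, ()), 1, [], {(0, 0, ())}⟩,
    ⟨fun U _ => ?_, by simp [hP]⟩, rfl⟩
  norm_num [QueryAlgorithm.acceptProb, QueryAlgorithm.finalState]

theorem solvableWithQueries_recurrenceTimeProblem {d : ℕ} (hd : 1 ≤ d) (t : ℕ) {ε : ℝ}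
    (hε : 0 < ε) {K : ℕ} (hK : 4 * √d / ε ≤ K) :
    SolvableWithQueries (recurrenceTimeProblem d t ε hε) (K * (2 * t)) := by
  have hd0 : (0 : ℝ) < d := by positivity
  have hK0 : (0 : ℝ) < K := lt_of_lt_of_le (by positivity) hK
  obtain ⟨Q, hQ, hQ'⟩ := exists_queryAlgorithm_ergodic hd t K (by exact_mod_cast hK0.ne')
  refine ⟨_, inferInstance, inferInstance, Q, ⟨fun U hU => ?_, fun U hU => ?_⟩, hQ⟩
  · have hU1 : (U : Matrix (Fin d) (Fin d) ℂ) ^ t = 1 := by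
      simpa using congrArg Subtype.val (show U ^ t = 1 from hU)
    have hv : ‖WithLp.toLp 2 (plusEntangled d)‖ = 1 := by
      rw [EuclideanSpace.norm_eq]; simp [sum_norm_sq_plusEntangled hd]
    rw [hQ', hU1]
    simp only [testerRotation_one_pow_mulVec hd, Finset.sum_const, Finset.card_range]
    rw [← Nat.cast_smul_eq_nsmul ℂ, WithLp.toLp_smul, norm_smul, hv, Complex.norm_natCast, mul_one,
      div_self hK0.ne']
    norm_num
  · set W := (U : Matrix (Fin d) (Fin d) ℂ) ^ t with hW
    have hWu : W ∈ Matrix.unitaryGroup (Fin d) ℂ := pow_mem U.2 t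
    have hU' : ε ≤ matrixSpectralNorm (W - 1) := hU
    set r := ‖WithLp.toLp 2 (plusEntangled d - swapReflection (Fin d) W *ᵥ plusEntangled d)‖
      with hr
    have hr2 : ε ^ 2 / d ≤ r ^ 2 := by
      rw [hr, norm_sq_plusEntangled_sub]
      gcongr
      exact (pow_le_pow_left₀ hε.le hU' 2).trans (matrixSpectralNorm_sq_le _)
    have hr0 : ε / √d ≤ r := by
      refine (sq_le_sq₀ (by positivity) (norm_nonneg _)).1 ?_
      rwa [div_pow, Real.sq_sqrt hd0.le]
    have hrpos : 0 < r := lt_of_lt_of_le (by positivity) hr0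
    have hle := norm_sum_reflections_pow_le (star_plusEntangled_dotProduct hd)
      (swapReflection_mem_unitaryGroup hWu) (isHermitian_swapReflection W)
      (fun h => hrpos.ne' (by rw [hr, h]; simp)) K
    rw [hQ']
    -- The constant 4 in `hK` makes `2 / (r K) ≤ 1 / 2`, so acceptance has probability at most `1 /
    -- 4`.
    have hhalf : ‖WithLp.toLp 2 (∑ k ∈ Finset.range K,
        testerRotation W ^ k *ᵥ plusEntangled d)‖ / K ≤ 1 / 2 := by
      rw [div_le_iff₀ hK0]
      refine hle.trans ?_
      rw [div_le_iff₀ hrpos]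
      have h4 : 4 * √d ≤ K * ε := (div_le_iff₀ hε).1 hK
      have h5 : ε ≤ r * √d := (div_le_iff₀ (by positivity)).1 hr0
      have h6 : K * ε ≤ K * (r * √d) := by gcongr
      have h7 : 4 * √d ≤ (K * r) * √d := by linarith
      have h8 := le_of_mul_le_mul_right h7 (by positivity)
      linarith
    calc _ ≤ (1 / 2 : ℝ) ^ 2 := by gcongr
      _ ≤ 1 / 3 := by norm_num

theorem mainTheorem5 :
    ∃ C : ℝ, 0 < C ∧
      ∀ (d t : ℕ) (ε : ℝ) (_hd : 1 ≤ d) (hε : 0 < ε),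
        ∃ T : ℕ, (T : ℝ) ≤ C * ((t : ℝ) * Real.sqrt (d : ℝ) / ε) ∧
          SolvableWithQueries (recurrenceTimeProblem d t ε hε) T := by
  refine ⟨12, by norm_num, fun d t ε hd hε => ?_⟩
  -- For `ε > 2` there are no no-instances, since `‖W - 1‖ ≤ 2`, and no query is needed. The split
  -- is forced by the ceiling: `K ≥ 1` would exceed the budget for large `ε`.
  rcases le_or_gt ε 2 with h2 | h2
  · refine ⟨⌈4 * √d / ε⌉₊ * (2 * t), ?_,
      solvableWithQueries_recurrenceTimeProblem hd t hε (Nat.le_ceil _)⟩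
    have hs : 1 ≤ √(d : ℝ) := Real.one_le_sqrt.2 (by exact_mod_cast hd)
    -- This absorbs the `+ 1` from rounding up: `4 + 2 = 6`, and the factor `2 * t` yields 12.
    have h1 : 1 ≤ 2 * (√d / ε) := by
      rw [← mul_div_assoc, le_div_iff₀ hε]; linarith
    have hc : (⌈4 * √d / ε⌉₊ : ℝ) ≤ 6 * (√d / ε) := by
      have := (Nat.ceil_lt_add_one (show 0 ≤ 4 * √(d : ℝ) / ε by positivity)).le
      rw [mul_div_assoc] at this ⊢
      linarith
    calc ((⌈4 * √d / ε⌉₊ * (2 * t) : ℕ) : ℝ) = ⌈4 * √d / ε⌉₊ * (2 * t) := by push_cast; ring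
      _ ≤ 6 * (√d / ε) * (2 * t) := by gcongr
      _ = 12 * (t * √d / ε) := by ring
  · refine ⟨0, by simp only [Nat.cast_zero]; positivity, solvableWithQueries_zero hd _ ?_⟩
    refine Set.eq_empty_of_forall_notMem fun U hU => ?_
    have hU' : ε ≤ matrixSpectralNorm ((U : Matrix (Fin d) (Fin d) ℂ) ^ t - 1) := hU
    linarith [matrixSpectralNorm_sub_one_le_two (pow_mem U.2 t)]
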